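/- Let $d\ge 0$ and $m\ge 1$ be integers and let $$\mathcal{SHL}(d,m)=\{f(\mathbf x)=\mathbf a^T\max(0,W\mathbf x+\mathbf b)+c:\ \mathbf a,\mathbf b\in\mathbb R^m,\ W\in\mathbb R^{m\times d},\ c\in\mathbb R\}$$ be the set of functions $f:\mathbb R^d\to\mathbb R$ computed by a single hidden layer of $m$ rectifier units (the maximum is taken entrywise). For such an $f$ let $\mathcal B_f=\{\mathbf x: f(\mathbf x)=0\}$. We say that $\mathcal B_f$ has $n$ facets if there are $\mathbf a_k\in\mathbb R^d\setminus\{0\}$ and $b_k\in\mathbb R$ ($1\le k\le n$) such that the sets $\Omega_k=\{\mathbf x:\mathbf a_k^T\mathbf x+b_k=0,\ f(\mathbf x)=0\}$ are distinct, $\mathcal B_f=\bigcup_{k=1}^n\Omega_k$, and no $\Omega_i$ is redundant, i.e. $\bigcup_{k\ne i}\Omega_k\ne\mathcal B_f$ for every $i$. Put $$G(d,m)=\sum_{k=0}^{d}\binom mk,\qquad C(d,m)=2\sum_{k=0}^{d-1}\binom{m-1}{k}.$$ Then the maximum number of facets of $\mathcal B_f$ over all $f\in\mathcal{SHL}(d,m)$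 exists and satisfies $$C(d,m)-1\ \le\ \max_{f\in\mathcal{SHL}(d,m)}\#(\mathcal B_f)\ \le\ G(d,m),$$ where the maximum is over all pairs $(f,n)$ such that $\mathcal B_f$ has $n$ facets. The same holds if, in addition, every facet $\Omega_k$ is required to be $(d-1)$-dimensional, i.e. to contain a nonempty relatively open subset of the hyperplane $\mathbf a_k^T\mathbf x+b_k=0$. -/

import Mathlib

/-- `G(d,m) = ∑_{k=0}^{d} (m choose k)`. -/
def regionCount (d m : ℕ) : ℕ := ∑ k ∈ Finset.range (d + 1), m.choose k

/-- `C(d,m) = 2 ∑_{k=0}^{d-1} (m-1 choose k)`, for `m ≥ 1`. -/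
def unboundedRegionCount (d m : ℕ) : ℕ := 2 * ∑ k ∈ Finset.range d, (m - 1).choose k

/-- The functions `x ↦ aᵀ max(0, W x + b) + c` on `ℝ^d` (the maximum taken entrywise) that are
computed by a single hidden layer of `m` rectifier units. -/
def SHL (d m : ℕ) : Set ((Fin d → ℝ) → ℝ) :=
  {f | ∃ (a : Fin m → ℝ) (W : Matrix (Fin m) (Fin d) ℝ) (b : Fin m → ℝ) (c : ℝ),
    f = fun x => a ⬝ᵥ (fun i => max 0 ((W.mulVec x + b) i)) + c}

/-- The boundary `{x | f x = 0}` of the classifier `f`. -/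
def boundary {d : ℕ} (f : (Fin d → ℝ) → ℝ) : Set (Fin d → ℝ) := {x | f x = 0}

/-- The part `{x | aᵀ x + b = 0, f x = 0}` of the boundary of `f` on the hyperplane `aᵀ x + b = 0`. -/
def boundarySection {d : ℕ} (f : (Fin d → ℝ) → ℝ) (a : Fin d → ℝ) (b : ℝ) : Set (Fin d → ℝ) :=
  {x | a ⬝ᵥ x + b = 0 ∧ f x = 0}

/-- The hyperplanes `(a k)ᵀ x + b k = 0`, `k < n`, cut the boundary of `f` into `n` facets: the
sections are distinct, they cover the boundary, and none of them is redundant. -/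
structure IsFacetDecomposition {d : ℕ} (f : (Fin d → ℝ) → ℝ) (n : ℕ)
    (a : Fin n → Fin d → ℝ) (b : Fin n → ℝ) : Prop where
  normal_ne_zero : ∀ k, a k ≠ 0
  distinct : Function.Injective fun k => boundarySection f (a k) (b k)
  cover : boundary f = ⋃ k, boundarySection f (a k) (b k)
  irredundant : ∀ i, (⋃ k ∈ {k | k ≠ i}, boundarySection f (a k) (b k)) ≠ boundary f

/-- The boundary of `f` has `n` facets. -/
def HasFacets {d : ℕ} (f : (Fin d → ℝ) → ℝ) (n : ℕ) : Prop :=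
  ∃ (a : Fin n → Fin d → ℝ) (b : Fin n → ℝ), IsFacetDecomposition f n a b

/-- The boundary of `f` has `n` facets, each of dimension `d - 1`: the facet contains a
neighbourhood, relative to its hyperplane, of some point of that hyperplane. -/
def HasFullDimFacets {d : ℕ} (f : (Fin d → ℝ) → ℝ) (n : ℕ) : Prop :=
  ∃ (a : Fin n → Fin d → ℝ) (b : Fin n → ℝ), IsFacetDecomposition f n a b ∧
    ∀ k, ∃ x, a k ⬝ᵥ x + b k = 0 ∧ ∀ᶠ y in nhds x, a k ⬝ᵥ y + b k = 0 → f y = 0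

/-!
On the set of points with a given pattern of active units, the network is affine, so its zeros
there form a convex set; a convex set covered by finitely many hyperplanes lies in one of them,
hence every irredundant facet uses up a pattern of its own. By the Sauer–Shelah lemma there are at
most `G(d, m)` patterns, since more than `d` affine functions on `ℝ^d` cannot be shattered.

For the lower bound, `∑ i, max 0 (w i ⬝ᵥ x) - 1` is the maximum of the affine functions
`(∑ i ∈ S, w i) ⬝ᵥ x - 1` over all sets `S` of units, and each nonempty `S` that is the positive
side of a chamber of the central arrangement of the hyperplanes `w i ⬝ᵥ x = 0` contributes one
facet. If the `w i` lie on the moment curve, then `w i ⬝ᵥ x` is the value at the node `i` of the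
polynomial of degree `< d` with coefficients `x`; prescribing a sign and fewer than `d` of the
`m - 1` gaps between nodes as the places of the sign changes gives `C(d, m)` chambers.
-/

open Finset Matrix Polynomial
open scoped Topology

section PositiveSupport

variable {ι X R : Type*}

theorem eventually_nhds_forall_pos_and_neg [Finite ι] [Zero R] [LinearOrder R]
    [TopologicalSpace R] [OrderClosedTopology R] (y : ι → R) :
    ∀ᶠ z in 𝓝 y, ∀ i, (0 < y i → 0 < z i) ∧ (y i < 0 → z i < 0) := by
  refine Filter.eventually_all.2 fun i => ?_
  have hi : Filter.Tendsto (fun z : ι → R => z i) (𝓝 y) (𝓝 (y i)) :=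
    (continuous_apply i).tendsto y
  rcases lt_trichotomy (y i) 0 with h | h | h
  · filter_upwards [hi.eventually_lt_const h] with z hz
    exact ⟨fun h' => (h.asymm h').elim, fun _ => hz⟩
  · simp [h]
  · filter_upwards [hi.eventually_const_lt h] with z hz
    exact ⟨fun _ => hz, fun h' => (h.asymm h').elim⟩

variable [Fintype ι]

/-- The set of indices of the positive coordinates of `y`. When `y` is the vector of
pre-activations of a layer of rectifiers, these are the active units. -/
def positiveSupport [Zero R] [LinearOrder R] (y : ι → R) : Finset ι := {i | 0 < y i}

@[simp]
theorem mem_positiveSupport [Zero R] [LinearOrder R] {y : ι → R} {i : ι} :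
    i ∈ positiveSupport y ↔ 0 < y i := by
  simp [positiveSupport]

theorem positiveSupport_smul [Semiring R] [LinearOrder R] [IsStrictOrderedRing R] {r : R}
    (hr : 0 < r) (y : ι → R) : positiveSupport (r • y) = positiveSupport y := by
  ext i
  simp [hr]

theorem eventually_nhds_positiveSupport_eq [Zero R] [LinearOrder R] [TopologicalSpace R]
    [OrderClosedTopology R] {y : ι → R} (hy : ∀ i, y i ≠ 0) :
    ∀ᶠ z in 𝓝 y, positiveSupport z = positiveSupport y := by
  filter_upwards [eventually_nhds_forall_pos_and_neg y] with z hz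
  ext i
  rw [mem_positiveSupport, mem_positiveSupport]
  exact ⟨fun h => (hy i).lt_or_gt.resolve_left fun h' => h.asymm ((hz i).2 h'), (hz i).1⟩

theorem sum_max_zero_eq_sum [AddCommMonoid R] [LinearOrder R] {y : ι → R} {S : Finset ι}
    (hpos : ∀ i ∈ S, 0 ≤ y i) (hneg : ∀ i ∉ S, y i ≤ 0) : ∑ i, max 0 (y i) = ∑ i ∈ S, y i := by
  rw [← sum_subset (subset_univ S) fun i _ hi => max_eq_left (hneg i hi)]
  exact sum_congr rfl fun i hi => max_eq_right (hpos i hi)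

theorem sum_lt_sum_positiveSupport [AddCommMonoid R] [LinearOrder R] [IsOrderedCancelAddMonoid R]
    {y : ι → R} (hy : ∀ i, y i ≠ 0) {T : Finset ι} (hT : T ≠ positiveSupport y) :
    ∑ i ∈ T, y i < ∑ i ∈ positiveSupport y, y i := by
  classical
  obtain ⟨j, hj⟩ : ∃ j, ¬(j ∈ T ↔ j ∈ positiveSupport y) := by
    by_contra! h
    exact hT (Finset.ext h)
  have hlt : ∑ i, (if i ∈ T then y i else 0) <
      ∑ i, (if i ∈ positiveSupport y then y i else 0) := by
    simp only [mem_positiveSupport] at hj ⊢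
    refine sum_lt_sum (fun i _ => ?_) ⟨j, mem_univ j, ?_⟩
    · split_ifs <;> grind
    · have := hy j
      split_ifs <;> grind
  simpa only [sum_ite_mem, univ_inter] using hlt

open Classical in
/-- The positive supports of the values of `g`: for a layer of rectifiers, the sets of units that
are simultaneously active at some input. -/
noncomputable def positivePatterns [Zero R] [LinearOrder R] (g : X → ι → R) : Finset (Finset ι) :=
  {S | ∃ x, positiveSupport (g x) = S}

@[simp]
theorem mem_positivePatterns [Zero R] [LinearOrder R] {g : X → ι → R} {S : Finset ι} :
    S ∈ positivePatterns g ↔ ∃ x, positiveSupport (g x) = S := by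
  simp [positivePatterns]

theorem exists_forall_pos_iff_of_shatters_positivePatterns [DecidableEq ι] [Zero R] [LinearOrder R]
    {g : X → ι → R} {T : Finset ι} (hT : (positivePatterns g).Shatters T) (q : ι → Prop) :
    ∃ x, ∀ i ∈ T, 0 < g x i ↔ q i := by
  classical
  obtain ⟨u, hu, hTu⟩ := hT (filter_subset q T)
  obtain ⟨x, rfl⟩ := mem_positivePatterns.1 hu
  exact ⟨x, fun i hi => by simpa [hi] using Finset.ext_iff.1 hTu i⟩

end PositiveSupport

section PatternCount

variable {ι 𝕜 E : Type*} [Field 𝕜] [LinearOrder 𝕜] [IsStrictOrderedRing 𝕜] [AddCommGroup E]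
  [Module 𝕜 E]

theorem exists_pos_and_sum_mul_eq_zero_of_finrank_lt_card [FiniteDimensional 𝕜 E]
    (g : E →ₗ[𝕜] ι → 𝕜) {T : Finset ι} (hT : Module.finrank 𝕜 E < #T) :
    ∃ c : ι → 𝕜, (∃ i ∈ T, 0 < c i) ∧ ∀ x, ∑ i ∈ T, c i * g x i = 0 := by
  have hdep : ¬LinearIndepOn 𝕜 (fun i => LinearMap.proj i ∘ₗ g) (T : Set ι) := fun h => by
    have := h.linearIndependent.fintype_card_le_finrank
    rw [Subspace.dual_finrank_eq] at this
    simp only [coe_sort_coe, Fintype.card_coe] at this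
    exact this.not_gt hT
  rw [linearIndepOn_finset_iff] at hdep
  push Not at hdep
  obtain ⟨c, hc, i, hi, hne⟩ := hdep
  have hsum : ∀ x, ∑ i ∈ T, c i * g x i = 0 := fun x => by
    simpa using LinearMap.congr_fun hc x
  rcases hne.lt_or_gt with hneg | hpos
  · exact ⟨-c, ⟨i, hi, by simpa using hneg⟩, fun x => by simp [hsum]⟩
  · exact ⟨c, ⟨i, hi, hpos⟩, hsum⟩

variable [Fintype ι]

theorem card_le_finrank_of_shatters_positivePatterns [DecidableEq ι] [FiniteDimensional 𝕜 E]
    {g : E →ᵃ[𝕜] ι → 𝕜} {T : Finset ι} (hT : (positivePatterns g).Shatters T) :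
    #T ≤ Module.finrank 𝕜 E := by
  by_contra! hlt
  obtain ⟨c, ⟨i₀, hi₀, hpos⟩, hsum⟩ :=
    exists_pos_and_sum_mul_eq_zero_of_finrank_lt_card g.linear hlt
  obtain ⟨x, hx⟩ := exists_forall_pos_iff_of_shatters_positivePatterns hT fun i => 0 < c i
  obtain ⟨y, hy⟩ := exists_forall_pos_iff_of_shatters_positivePatterns hT fun i => ¬0 < c i
  have hlin : ∀ i, g.linear (x - y) i = g x i - g y i := fun i => by
    rw [← vsub_eq_sub, g.linearMap_vsub, vsub_eq_sub, Pi.sub_apply]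
  refine (hsum (x - y)).not_gt (sum_pos' (fun i hi => ?_) ⟨i₀, hi₀, ?_⟩)
  · rw [hlin]
    by_cases hci : 0 < c i
    · have hxi := (hx i hi).2 hci
      have hyi := not_lt.1 fun h => (hy i hi).1 h hci
      exact mul_nonneg hci.le (by linarith)
    · have hxi := not_lt.1 (mt (hx i hi).1 hci)
      have hyi := (hy i hi).2 hci
      exact mul_nonneg_of_nonpos_of_nonpos (not_lt.1 hci) (by linarith)
  · rw [hlin]
    have hxi := (hx i₀ hi₀).2 hpos
    have hyi := not_lt.1 fun h => (hy i₀ hi₀).1 h hpos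
    exact mul_pos hpos (by linarith)

theorem card_positivePatterns_le [FiniteDimensional 𝕜 E] (g : E →ᵃ[𝕜] ι → 𝕜) :
    #(positivePatterns g) ≤ regionCount (Module.finrank 𝕜 E) (Fintype.card ι) := by
  classical
  have hvc : (positivePatterns g).vcDim ≤ Module.finrank 𝕜 E :=
    Finset.sup_le fun T hT => card_le_finrank_of_shatters_positivePatterns (mem_shatterer.1 hT)
  calc #(positivePatterns g) ≤ #(positivePatterns g).shatterer := card_le_card_shatterer _
    _ ≤ ∑ k ∈ Iic (positivePatterns g).vcDim, (Fintype.card ι).choose k :=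
      card_shatterer_le_sum_vcDim
    _ ≤ regionCount (Module.finrank 𝕜 E) (Fintype.card ι) :=
      sum_le_sum_of_subset fun k hk => mem_range_succ_iff.2 ((mem_Iic.1 hk).trans hvc)

end PatternCount

section ConvexCover

variable {ι 𝕜 E : Type*} [Field 𝕜] [AddCommGroup E] [Module 𝕜 E]

theorem lineMap_mem_of_lineMap_mem {s : AffineSubspace 𝕜 E} {x y : E} {t t' : 𝕜} (hne : t ≠ t')
    (ht : AffineMap.lineMap x y t ∈ s) (ht' : AffineMap.lineMap x y t' ∈ s) (r : 𝕜) :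
    AffineMap.lineMap x y r ∈ s := by
  have hr : AffineMap.lineMap t t' ((r - t) / (t' - t)) = r := by
    have := sub_ne_zero.2 hne.symm
    rw [AffineMap.lineMap_apply_ring']
    field_simp
    ring
  rw [← hr, AffineMap.apply_lineMap]
  exact AffineMap.lineMap_mem _ ht ht'

variable [LinearOrder 𝕜] [IsStrictOrderedRing 𝕜]

-- If `x ∈ C` avoids one of the subspaces, then by the pigeonhole principle the line through `x`
-- and any other point of `C` meets one of the remaining ones twice, hence lies in it.
theorem exists_subset_of_convex_of_subset_biUnion {C : Set E} (hC : Convex 𝕜 C)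
    (hne : C.Nonempty) (s : ι → AffineSubspace 𝕜 E) (T : Finset ι)
    (hcover : ∀ x ∈ C, ∃ i ∈ T, x ∈ s i) : ∃ i ∈ T, C ⊆ s i := by
  classical
  induction T using Finset.induction_on with
  | empty =>
    obtain ⟨x, hx⟩ := hne
    simpa using hcover x hx
  | insert j T _ ih =>
    by_cases hCj : C ⊆ s j
    · exact ⟨j, mem_insert_self j T, hCj⟩
    obtain ⟨x, hx, hxj⟩ := Set.not_subset.1 hCj
    suffices hT : ∀ y ∈ C, ∃ i ∈ T, y ∈ s i by
      obtain ⟨i, hi, hCi⟩ := ih hT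
      exact ⟨i, mem_insert_of_mem hi, hCi⟩
    intro y hy
    have hseg : ∀ t ∈ Set.Ioo (0 : 𝕜) 1, ∃ i ∈ insert j T, AffineMap.lineMap x y t ∈ s i :=
      fun t ht => hcover _ (hC.lineMap_mem hx hy ⟨ht.1.le, ht.2.le⟩)
    have : Nonempty ι := ⟨j⟩
    choose! φ hφT hφ using hseg
    have hmaps : Set.MapsTo φ (Set.Ioo 0 1) (insert j T : Finset ι) := hφT
    obtain ⟨t, ht, t', ht', htt', heq⟩ :=
      (Set.Ioo_infinite (zero_lt_one' 𝕜)).exists_ne_map_eq_of_mapsTo hmaps (finite_toSet _)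
    have hline := lineMap_mem_of_lineMap_mem htt' (hφ t ht) (heq ▸ hφ t' ht')
    have hyφ : y ∈ s (φ t) := by simpa using hline 1
    have hxφ : x ∈ s (φ t) := by simpa using hline 0
    exact ⟨φ t, mem_of_mem_insert_of_ne (hφT t ht) fun h => hxj (h ▸ hxφ), hyφ⟩

end ConvexCover

section Hyperplane

variable {κ R : Type*} [Fintype κ] [CommRing R]

/-- The solution set of `w ⬝ᵥ x + β = 0`, a hyperplane when `w ≠ 0`. -/
def hyperplane (w : κ → R) (β : R) : AffineSubspace R (κ → R) where
  carrier := {x | w ⬝ᵥ x + β = 0}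
  smul_vsub_vadd_mem' r x y z hx hy hz := by
    simp only [Set.mem_ofPred_eq, vsub_eq_sub, vadd_eq_add, dotProduct_add, dotProduct_smul,
      dotProduct_sub, smul_eq_mul] at hx hy hz ⊢
    linear_combination r * hx - r * hy + hz

@[simp]
theorem mem_hyperplane {w : κ → R} {β : R} {x : κ → R} :
    x ∈ hyperplane w β ↔ w ⬝ᵥ x + β = 0 :=
  Iff.rfl

theorem hyperplane_ne_top {w : κ → R} (hw : w ≠ 0) (β : R) : hyperplane w β ≠ ⊤ := by
  intro h
  have hmem : ∀ x, w ⬝ᵥ x + β = 0 := fun x => by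
    rw [← mem_hyperplane, h]
    exact AffineSubspace.mem_top R _ x
  have hβ : β = 0 := by simpa using hmem 0
  exact hw (dotProduct_eq_zero w fun x => by simpa [hβ] using hmem x)

theorem dense_setOf_forall_mulVec_ne_zero {ι : Type*} [Countable ι] {W : Matrix ι κ ℝ}
    (hW : ∀ i, W.row i ≠ 0) : Dense {x | ∀ i, (W *ᵥ x) i ≠ 0} := by
  refine MeasureTheory.Measure.dense_of_ae (μ := MeasureTheory.volume)
    (MeasureTheory.ae_all_iff.2 fun i => ?_)
  have hnull := MeasureTheory.Measure.addHaar_affineSubspace MeasureTheory.volume _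
    (hyperplane_ne_top (hW i) 0)
  filter_upwards [MeasureTheory.measure_eq_zero_iff_ae_notMem.1 hnull] with x hx h
  exact hx ((add_zero _).trans h)

end Hyperplane

section FacetDecomposition

variable {d n : ℕ} {f : (Fin d → ℝ) → ℝ} {a : Fin n → Fin d → ℝ} {b : Fin n → ℝ}

theorem isFacetDecomposition_iff : IsFacetDecomposition f n a b ↔
    (∀ k, a k ≠ 0) ∧ (∀ x ∈ boundary f, ∃ k, x ∈ hyperplane (a k) (b k)) ∧
      ∀ k, ∃ x ∈ boundary f, ∀ l, x ∈ hyperplane (a l) (b l) ↔ l = k := by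
  constructor
  · intro h
    have hcover : ∀ x ∈ boundary f, ∃ k, x ∈ hyperplane (a k) (b k) := fun x hx => by
      rw [h.cover] at hx
      exact (Set.mem_iUnion.1 hx).imp fun _ hk => hk.1
    refine ⟨h.normal_ne_zero, hcover, fun k => ?_⟩
    by_contra! hk
    refine h.irredundant k (Set.Subset.antisymm (Set.iUnion₂_subset fun l _ x hx => hx.2) ?_)
    intro x hx
    obtain ⟨l, hl⟩ := hcover x hx
    obtain ⟨l', hl' | hl'⟩ := hk x hx
    · exact Set.mem_iUnion₂.2 ⟨l', hl'.2, hl'.1, hx⟩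
    · exact Set.mem_iUnion₂.2 ⟨l, fun h => hl'.1 (hl'.2 ▸ h ▸ hl), hl, hx⟩
  · rintro ⟨ha, hcover, hprivate⟩
    refine ⟨ha, fun k l hkl => ?_, ?_, fun k hk => ?_⟩
    · obtain ⟨x, hx, hxl⟩ := hprivate l
      have hmem : x ∈ boundarySection f (a l) (b l) := ⟨(hxl l).2 rfl, hx⟩
      exact (hxl k).1 ((Set.ext_iff.1 hkl x).2 hmem).1
    · refine Set.Subset.antisymm (fun x hx => ?_) (Set.iUnion_subset fun k x hx => hx.2)
      obtain ⟨k, hk⟩ := hcover x hx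
      exact Set.mem_iUnion.2 ⟨k, hk, hx⟩
    · obtain ⟨x, hx, hxk⟩ := hprivate k
      rw [← hk] at hx
      obtain ⟨l, hl, hxl⟩ := Set.mem_iUnion₂.1 hx
      exact hl ((hxk l).1 hxl.1)

theorem IsFacetDecomposition.le_card_of_convex_cover {ι : Type*} [Fintype ι]
    (h : IsFacetDecomposition f n a b) {C : ι → Set (Fin d → ℝ)} (hconv : ∀ i, Convex ℝ (C i))
    (hC : boundary f = ⋃ i, C i) : n ≤ Fintype.card ι := by
  obtain ⟨-, hcover, hprivate⟩ := isFacetDecomposition_iff.1 h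
  choose p hp hpk using hprivate
  have hmem : ∀ k, ∃ i, p k ∈ C i := fun k => Set.mem_iUnion.1 (hC ▸ hp k)
  choose ψ hψ using hmem
  have hinj : Function.Injective ψ := by
    intro k l hkl
    obtain ⟨j, -, hj⟩ := exists_subset_of_convex_of_subset_biUnion (hconv (ψ k)) ⟨p k, hψ k⟩
      (fun j => hyperplane (a j) (b j)) univ fun x hx => by
        simpa using hcover x (hC ▸ Set.mem_iUnion.2 ⟨ψ k, hx⟩)
    have hjk := (hpk k j).1 (hj (hψ k))
    have hjl := (hpk l j).1 (hj (hkl ▸ hψ l))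
    exact hjk.symm.trans hjl
  simpa using Fintype.card_le_of_injective ψ hinj

theorem hasFullDimFacets_card {ι : Type*} [Fintype ι] {a : ι → Fin d → ℝ} {b : ι → ℝ}
    (ha : ∀ k, a k ≠ 0) (hcover : ∀ x ∈ boundary f, ∃ k, x ∈ hyperplane (a k) (b k))
    (p : ι → Fin d → ℝ) (hp : ∀ k l, p k ∈ hyperplane (a l) (b l) ↔ l = k)
    (hloc : ∀ k, ∀ᶠ y in 𝓝 (p k), y ∈ hyperplane (a k) (b k) → f y = 0) :
    HasFullDimFacets f (Fintype.card ι) := by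
  let e := Fintype.equivFin ι
  have hpk : ∀ k, p k ∈ hyperplane (a k) (b k) := fun k => (hp k k).2 rfl
  refine ⟨a ∘ e.symm, b ∘ e.symm, isFacetDecomposition_iff.2 ⟨fun k => ha _, fun x hx => ?_,
    fun k => ⟨p (e.symm k), (hloc _).self_of_nhds (hpk _), fun l => ?_⟩⟩,
    fun k => ⟨p (e.symm k), hpk _, hloc _⟩⟩
  · obtain ⟨k, hk⟩ := hcover x hx
    exact ⟨e k, by simpa using hk⟩
  · exact (hp _ _).trans e.symm.injective.eq_iff

theorem HasFullDimFacets.hasFacets (h : HasFullDimFacets f n) : HasFacets f n :=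
  let ⟨a, b, hab, _⟩ := h
  ⟨a, b, hab⟩

end FacetDecomposition

section UpperBound

variable {ι κ : Type*} [Fintype κ]

/-- The affine map `x ↦ W *ᵥ x + b`, the pre-activation of a layer with weights `W` and
biases `b`. -/
def affineLayer (W : Matrix ι κ ℝ) (b : ι → ℝ) : (κ → ℝ) →ᵃ[ℝ] ι → ℝ :=
  W.mulVecLin.toAffineMap + AffineMap.const ℝ _ b

@[simp]
theorem affineLayer_apply (W : Matrix ι κ ℝ) (b : ι → ℝ) (x : κ → ℝ) :
    affineLayer W b x = W *ᵥ x + b :=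
  rfl

variable [Fintype ι]

theorem dotProduct_max_zero (a y : ι → ℝ) :
    a ⬝ᵥ (fun i => max 0 (y i)) = ∑ i ∈ positiveSupport y, a i * y i := by
  rw [dotProduct, positiveSupport, sum_filter]
  refine sum_congr rfl fun i _ => ?_
  split_ifs with h
  · rw [max_eq_right h.le]
  · rw [max_eq_left (not_lt.1 h), mul_zero]

theorem convex_setOf_positiveSupport_eq (S : Finset ι) :
    Convex ℝ {y : ι → ℝ | positiveSupport y = S} := by
  classical
  have hpi : {y : ι → ℝ | positiveSupport y = S} =
      Set.univ.pi fun i => if i ∈ S then Set.Ioi 0 else Set.Iic 0 := by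
    ext y
    simp only [Set.mem_ofPred_eq, Finset.ext_iff, mem_positiveSupport, Set.mem_univ_pi]
    refine forall_congr' fun i => ?_
    split_ifs with hi <;> simp [hi]
  rw [hpi]
  refine convex_pi fun i _ => ?_
  split_ifs
  · exact convex_Ioi 0
  · exact convex_Iic 0

theorem convex_setOf_positiveSupport_eq_and_dotProduct_max_zero_eq (a : ι → ℝ) (c : ℝ)
    (S : Finset ι) :
    Convex ℝ {y : ι → ℝ | positiveSupport y = S ∧ a ⬝ᵥ (fun i => max 0 (y i)) + c = 0} := by
  have hset : {y : ι → ℝ | positiveSupport y = S ∧ a ⬝ᵥ (fun i => max 0 (y i)) + c = 0} =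
      {y | positiveSupport y = S} ∩ {y | ∑ i ∈ S, a i * y i = -c} := by
    ext y
    refine and_congr_right fun hy => ?_
    rw [dotProduct_max_zero, hy, Set.mem_ofPred_eq, eq_neg_iff_add_eq_zero]
  rw [hset]
  refine (convex_setOf_positiveSupport_eq S).inter
    (convex_hyperplane ⟨fun y z => ?_, fun r y => ?_⟩ _)
  · simp only [Pi.add_apply, mul_add, sum_add_distrib]
  · simp only [Pi.smul_apply, smul_eq_mul, mul_sum, mul_left_comm]

theorem HasFacets.le_regionCount {d m n : ℕ} {f : (Fin d → ℝ) → ℝ} (h : HasFacets f n)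
    (hf : f ∈ SHL d m) : n ≤ regionCount d m := by
  obtain ⟨α, W, β, c, rfl⟩ := hf
  obtain ⟨a, b, hab⟩ := h
  let g := affineLayer W β
  let Z : Finset (Fin m) → Set (Fin m → ℝ) := fun S =>
    {y | positiveSupport y = S ∧ α ⬝ᵥ (fun i => max 0 (y i)) + c = 0}
  have hcover : boundary (fun x => α ⬝ᵥ (fun i => max 0 ((W.mulVec x + β) i)) + c) =
      ⋃ S : positivePatterns g, g ⁻¹' Z S := by
    ext x
    simp [boundary, Z, g]
  calc n ≤ Fintype.card (positivePatterns g) := hab.le_card_of_convex_cover (fun S =>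
        (convex_setOf_positiveSupport_eq_and_dotProduct_max_zero_eq α c S).affine_preimage g) hcover
    _ = #(positivePatterns g) := Fintype.card_coe _
    _ ≤ regionCount d m := by simpa using card_positivePatterns_le g

end UpperBound

section Chambers

open Classical in
/-- The positive supports of `W *ᵥ x` over the points `x` at which no coordinate of `W *ᵥ x`
vanishes. They are in bijection with the chambers of the central arrangement of the hyperplanes
orthogonal to the rows of `W`. -/
noncomputable def chamberPatterns {ι κ R : Type*} [Fintype ι] [Fintype κ] [Semiring R]
    [LinearOrder R] (W : Matrix ι κ R) : Finset (Finset ι) :=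
  {S | ∃ x, (∀ i, (W *ᵥ x) i ≠ 0) ∧ positiveSupport (W *ᵥ x) = S}

@[simp]
theorem mem_chamberPatterns {ι κ R : Type*} [Fintype ι] [Fintype κ] [Semiring R] [LinearOrder R]
    {W : Matrix ι κ R} {S : Finset ι} :
    S ∈ chamberPatterns W ↔ ∃ x, (∀ i, (W *ᵥ x) i ≠ 0) ∧ positiveSupport (W *ᵥ x) = S := by
  simp [chamberPatterns]

theorem exists_mulVec_ne_zero_and_sum_eq_one {ι κ 𝕜 : Type*} [Fintype ι] [Fintype κ] [Field 𝕜]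
    [LinearOrder 𝕜] [IsStrictOrderedRing 𝕜] {W : Matrix ι κ 𝕜} {S : Finset ι}
    (hS : S ∈ chamberPatterns W) (hne : S.Nonempty) :
    ∃ x, (∀ i, (W *ᵥ x) i ≠ 0) ∧ positiveSupport (W *ᵥ x) = S ∧ ∑ i ∈ S, (W *ᵥ x) i = 1 := by
  obtain ⟨x, hx, rfl⟩ := mem_chamberPatterns.1 hS
  set r := ∑ i ∈ positiveSupport (W *ᵥ x), (W *ᵥ x) i with hr
  have hpos : 0 < r := sum_pos (fun i hi => mem_positiveSupport.1 hi) hne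
  refine ⟨r⁻¹ • x, fun i => ?_, ?_, ?_⟩
  · rw [mulVec_smul]
    exact mul_ne_zero (inv_ne_zero hpos.ne') (hx i)
  · rw [mulVec_smul, positiveSupport_smul (inv_pos.2 hpos)]
  · simp only [mulVec_smul, Pi.smul_apply, smul_eq_mul]
    rw [← mul_sum, ← hr, inv_mul_cancel₀ hpos.ne']

-- The point `x` lies in the closure of the chamber of `S`.
theorem exists_mem_chamberPatterns_nonneg_and_nonpos {ι κ : Type*} [Fintype ι] [Fintype κ]
    {W : Matrix ι κ ℝ} (hW : ∀ i, W.row i ≠ 0) (x : κ → ℝ) :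
    ∃ S ∈ chamberPatterns W, (∀ i ∈ S, 0 ≤ (W *ᵥ x) i) ∧ ∀ i ∉ S, (W *ᵥ x) i ≤ 0 := by
  have hcont : Continuous fun y => W *ᵥ y := continuous_const.matrix_mulVec continuous_id
  have hnear := hcont.tendsto x (eventually_nhds_forall_pos_and_neg (W *ᵥ x))
  obtain ⟨y, hy, hyx⟩ := ((mem_closure_iff_frequently.1
    (dense_setOf_forall_mulVec_ne_zero hW x)).and_eventually hnear).exists
  refine ⟨positiveSupport (W *ᵥ y), mem_chamberPatterns.2 ⟨y, hy, rfl⟩, fun i hi => ?_,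
    fun i hi => ?_⟩
  · exact not_lt.1 fun h => ((hyx i).2 h).asymm (mem_positiveSupport.1 hi)
  · exact not_lt.1 fun h => hi (mem_positiveSupport.2 ((hyx i).1 h))

end Chambers

section ConicalNetwork

variable {ι : Type*} {d : ℕ}

theorem mem_hyperplane_sum_iff {W : Matrix ι (Fin d) ℝ} {S : Finset ι} {x : Fin d → ℝ} :
    x ∈ hyperplane (∑ i ∈ S, W.row i) (-1) ↔ ∑ i ∈ S, (W *ᵥ x) i = 1 := by
  rw [mem_hyperplane, sum_dotProduct, add_neg_eq_zero]
  rfl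

variable [Fintype ι]

/-- The network `x ↦ ∑ i, max 0 ((W *ᵥ x) i) - 1` without biases and with unit output weights. Its
boundary has one facet in each chamber of the arrangement of `W` where some unit is active. -/
noncomputable def conicalNetwork (W : Matrix ι (Fin d) ℝ) : (Fin d → ℝ) → ℝ :=
  fun x => ∑ i, max 0 ((W *ᵥ x) i) - 1

theorem conicalNetwork_mem_SHL {m : ℕ} (W : Matrix (Fin m) (Fin d) ℝ) :
    conicalNetwork W ∈ SHL d m :=
  ⟨1, W, 0, -1, funext fun x => by
    rw [one_dotProduct, add_zero, conicalNetwork, sub_eq_add_neg]⟩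

theorem conicalNetwork_eq_zero_iff {W : Matrix ι (Fin d) ℝ} {S : Finset ι} {x : Fin d → ℝ}
    (hpos : ∀ i ∈ S, 0 ≤ (W *ᵥ x) i) (hneg : ∀ i ∉ S, (W *ᵥ x) i ≤ 0) :
    conicalNetwork W x = 0 ↔ x ∈ hyperplane (∑ i ∈ S, W.row i) (-1) := by
  rw [conicalNetwork, sum_max_zero_eq_sum hpos hneg, sub_eq_zero, mem_hyperplane_sum_iff]

theorem hasFullDimFacets_conicalNetwork [DecidableEq ι] {W : Matrix ι (Fin d) ℝ}
    (hW : ∀ i, W.row i ≠ 0) :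
    HasFullDimFacets (conicalNetwork W) #((chamberPatterns W).erase ∅) := by
  let P := (chamberPatterns W).erase ∅
  have hpoint : ∀ S : P, ∃ x, (∀ i, (W *ᵥ x) i ≠ 0) ∧ positiveSupport (W *ᵥ x) = S ∧
      ∑ i ∈ (S : Finset ι), (W *ᵥ x) i = 1 := fun S =>
    exists_mulVec_ne_zero_and_sum_eq_one (mem_of_mem_erase S.2)
      (nonempty_iff_ne_empty.2 (ne_of_mem_erase S.2))
  choose p hp_ne hp_support hp_sum using hpoint
  rw [← Fintype.card_coe]
  refine hasFullDimFacets_card (a := fun S : P => ∑ i ∈ (S : Finset ι), W.row i) (b := fun _ => -1)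
    (fun S h => ?normal) (fun x hx => ?cover) p (fun S T => ?private_point) fun S => ?full_dim
  case normal =>
    have hpS := mem_hyperplane_sum_iff.2 (hp_sum S)
    simp [h] at hpS
  case cover =>
    obtain ⟨S, hS, hpos, hneg⟩ := exists_mem_chamberPatterns_nonneg_and_nonpos hW x
    have hxS := (conicalNetwork_eq_zero_iff hpos hneg).1 hx
    have hne : S ≠ ∅ := by
      rintro rfl
      simp at hxS
    exact ⟨⟨S, mem_erase.2 ⟨hne, hS⟩⟩, hxS⟩
  case private_point =>
    refine ⟨fun h => ?_, by rintro rfl; exact mem_hyperplane_sum_iff.2 (hp_sum _)⟩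
    by_contra hTS
    have hlt := sum_lt_sum_positiveSupport (hp_ne S) (T := T)
      fun h => hTS (Subtype.ext (h.trans (hp_support S)))
    rw [mem_hyperplane_sum_iff.1 h, hp_support, hp_sum] at hlt
    exact hlt.false
  case full_dim =>
    have hcont : Continuous fun y => W *ᵥ y := continuous_const.matrix_mulVec continuous_id
    filter_upwards [hcont.tendsto (p S) (eventually_nhds_positiveSupport_eq (hp_ne S))] with y hy
    have hyS : positiveSupport (W *ᵥ y) = S := hy.trans (hp_support S)
    refine (conicalNetwork_eq_zero_iff (fun i hi => ?_) fun i hi => ?_).2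
    · exact (mem_positiveSupport.1 (hyS ▸ hi)).le
    · exact not_lt.1 fun h => hi (hyS ▸ mem_positiveSupport.2 h)

end ConicalNetwork

section MomentCurve

theorem mul_neg_iff_not_pos_iff_pos {R : Type*} [Ring R] [LinearOrder R] [IsStrictOrderedRing R]
    {u w : R} (hu : u ≠ 0) (hw : w ≠ 0) : u * w < 0 ↔ ¬(0 < u ↔ 0 < w) := by
  rcases hu.lt_or_gt with hu | hu <;> rcases hw.lt_or_gt with hw | hw <;>
    simp [mul_neg_iff, hu, hw, hu.not_gt, hw.not_gt]

theorem rectVandermonde_one_mulVec_coeff {α R : Type*} [CommRing R] (v : α → R) {p : R[X]} {n : ℕ}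
    (hp : p.natDegree < n) :
    rectVandermonde v 1 n *ᵥ (fun j => p.coeff j) = fun i => p.eval (v i) := by
  ext i
  rw [eval_eq_sum_range' hp, ← Fin.sum_univ_eq_sum_range fun j => p.coeff j * v i ^ j]
  simp [mulVec, dotProduct, rectVandermonde_apply, mul_comm]

variable {𝕜 : Type*} [Field 𝕜] [LinearOrder 𝕜] [IsStrictOrderedRing 𝕜] {n : ℕ}

/-- The polynomial with leading coefficient `ε` and the simple roots `j + 1 / 2` for `j ∈ J`. Among
the nodes `0, …, n` it changes sign exactly in the gaps between `j` and `j + 1` with `j ∈ J`. -/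
noncomputable def gapPolynomial (𝕜 : Type*) [Field 𝕜] (ε : ℤˣ) (J : Finset (Fin n)) : 𝕜[X] :=
  C ((ε : ℤ) : 𝕜) * ∏ j ∈ J, (X - C ((j : 𝕜) + 1 / 2))

theorem eval_gapPolynomial {𝕜 : Type*} [Field 𝕜] (ε : ℤˣ) (J : Finset (Fin n)) (t : 𝕜) :
    (gapPolynomial 𝕜 ε J).eval t = ((ε : ℤ) : 𝕜) * ∏ j ∈ J, (t - ((j : 𝕜) + 1 / 2)) := by
  simp [gapPolynomial, eval_prod]

theorem natDegree_gapPolynomial_le {𝕜 : Type*} [Field 𝕜] (ε : ℤˣ) (J : Finset (Fin n)) :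
    (gapPolynomial 𝕜 ε J).natDegree ≤ #J :=
  (natDegree_C_mul_le _ _).trans (natDegree_finsetProd_X_sub_C_eq_card J _).le

theorem eval_gapPolynomial_natCast_ne_zero (ε : ℤˣ) (J : Finset (Fin n)) (i : ℕ) :
    (gapPolynomial 𝕜 ε J).eval (i : 𝕜) ≠ 0 := by
  rw [eval_gapPolynomial]
  refine mul_ne_zero (by exact_mod_cast ε.ne_zero) (prod_ne_zero_iff.2 fun j _ h => ?_)
  have hparity : (2 * i : 𝕜) = 2 * (j : ℕ) + 1 := by linarith
  norm_cast at hparity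
  omega

theorem eval_gapPolynomial_castSucc_mul_succ_neg_iff (ε : ℤˣ) (J : Finset (Fin n)) (i : Fin n) :
    (gapPolynomial 𝕜 ε J).eval (i.castSucc : 𝕜) * (gapPolynomial 𝕜 ε J).eval (i.succ : 𝕜) < 0 ↔
      i ∈ J := by
  have hε : ((ε : ℤ) : 𝕜) * ((ε : ℤ) : 𝕜) = 1 := by
    rw [← Int.cast_mul, Int.units_coe_mul_self, Int.cast_one]
  have hne : ∀ j, j ≠ i →
      0 < ((i.castSucc : 𝕜) - ((j : 𝕜) + 1 / 2)) * ((i.succ : 𝕜) - ((j : 𝕜) + 1 / 2)) := by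
    intro j hj
    simp only [Fin.val_castSucc, Fin.val_succ, Nat.cast_add, Nat.cast_one]
    rcases lt_or_gt_of_ne hj with h | h
    · have : (j : 𝕜) + 1 ≤ (i : 𝕜) := by exact_mod_cast h
      exact mul_pos (by linarith) (by linarith)
    · have : (i : 𝕜) + 1 ≤ (j : 𝕜) := by exact_mod_cast h
      exact mul_pos_of_neg_of_neg (by linarith) (by linarith)
  rw [eval_gapPolynomial, eval_gapPolynomial, mul_mul_mul_comm, hε, one_mul, ← prod_mul_distrib]
  constructor
  · intro h
    by_contra hi
    exact h.not_gt (prod_pos fun j hj => hne j fun hji => hi (hji ▸ hj))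
  · intro hi
    rw [← mul_prod_erase J _ hi]
    refine mul_neg_of_neg_of_pos ?_ (prod_pos fun j hj => hne j (ne_of_mem_erase hj))
    simp only [Fin.val_castSucc, Fin.val_succ, Nat.cast_add, Nat.cast_one]
    exact mul_neg_of_neg_of_pos (by linarith) (by linarith)

/-- The nodes among `0, …, n` at which `gapPolynomial 𝕜 ε J` is positive. -/
noncomputable def gapPattern (𝕜 : Type*) [Field 𝕜] [LinearOrder 𝕜] (ε : ℤˣ)
    (J : Finset (Fin n)) : Finset (Fin (n + 1)) :=
  positiveSupport fun i => (gapPolynomial 𝕜 ε J).eval (i : 𝕜)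

theorem mem_iff_not_castSucc_iff_succ_mem_gapPattern (ε : ℤˣ) (J : Finset (Fin n)) (i : Fin n) :
    i ∈ J ↔ ¬(i.castSucc ∈ gapPattern 𝕜 ε J ↔ i.succ ∈ gapPattern 𝕜 ε J) := by
  rw [← eval_gapPolynomial_castSucc_mul_succ_neg_iff (𝕜 := 𝕜) ε J i, gapPattern,
    mem_positiveSupport, mem_positiveSupport]
  exact mul_neg_iff_not_pos_iff_pos (eval_gapPolynomial_natCast_ne_zero ε J _)
    (eval_gapPolynomial_natCast_ne_zero ε J _)

theorem gapPattern_neg (ε : ℤˣ) (J : Finset (Fin n)) :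
    gapPattern 𝕜 (-ε) J = (gapPattern 𝕜 ε J)ᶜ := by
  ext i
  have hneg : (gapPolynomial 𝕜 (-ε) J).eval (i : 𝕜) = -(gapPolynomial 𝕜 ε J).eval (i : 𝕜) := by
    simp [eval_gapPolynomial]
  have hne := eval_gapPolynomial_natCast_ne_zero (𝕜 := 𝕜) ε J i
  rw [mem_compl, gapPattern, gapPattern, mem_positiveSupport, mem_positiveSupport, hneg,
    neg_pos, not_lt, hne.le_iff_lt]

theorem gapPattern_injective :
    Function.Injective fun q : ℤˣ × Finset (Fin n) => gapPattern 𝕜 q.1 q.2 := by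
  rintro ⟨ε, J⟩ ⟨δ, K⟩ h
  obtain rfl : J = K := by
    ext i
    rw [mem_iff_not_castSucc_iff_succ_mem_gapPattern (𝕜 := 𝕜) ε J,
      mem_iff_not_castSucc_iff_succ_mem_gapPattern (𝕜 := 𝕜) δ K, show gapPattern 𝕜 ε J = _ from h]
  by_contra hne
  obtain rfl : ε = -δ := Int.units_ne_iff_eq_neg.1 fun hεδ => hne (hεδ ▸ rfl)
  exact compl_ne_self ((gapPattern_neg (𝕜 := 𝕜) δ J).symm.trans h)

theorem gapPattern_mem_chamberPatterns {d : ℕ} {J : Finset (Fin n)} (hJ : #J < d) (ε : ℤˣ) :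
    gapPattern 𝕜 ε J ∈
      chamberPatterns (rectVandermonde (fun i : Fin (n + 1) => (i : 𝕜)) 1 d) := by
  have heval := rectVandermonde_one_mulVec_coeff (fun i : Fin (n + 1) => (i : 𝕜))
    ((natDegree_gapPolynomial_le (𝕜 := 𝕜) ε J).trans_lt hJ)
  refine mem_chamberPatterns.2 ⟨_, fun i => ?_, congrArg positiveSupport heval⟩
  rw [heval]
  exact eval_gapPolynomial_natCast_ne_zero ε J i

theorem card_filter_card_lt (n d : ℕ) :
    #{J : Finset (Fin n) | #J < d} = ∑ k ∈ range d, n.choose k := by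
  rw [card_eq_sum_card_fiberwise (f := card) (t := range d) fun J hJ => by simpa using hJ]
  refine sum_congr rfl fun k hk => ?_
  have hfiber : {J ∈ ({J | #J < d} : Finset (Finset (Fin n))) | #J = k} =
      powersetCard k univ := by
    ext J
    simp only [mem_filter, mem_powersetCard_univ, and_iff_right_iff_imp]
    rintro rfl
    exact ⟨mem_univ _, mem_range.1 hk⟩
  rw [hfiber, card_powersetCard, card_fin]

theorem unboundedRegionCount_le_card_chamberPatterns (d n : ℕ) :
    unboundedRegionCount d (n + 1) ≤
      #(chamberPatterns (rectVandermonde (fun i : Fin (n + 1) => (i : 𝕜)) 1 d)) := by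
  calc unboundedRegionCount d (n + 1)
      = #((univ : Finset ℤˣ) ×ˢ ({J | #J < d} : Finset (Finset (Fin n)))) := by
        rw [card_product, card_filter_card_lt, card_univ, Fintype.card_units_int]
        rfl
    _ ≤ _ := card_le_card_of_injOn (fun q => gapPattern 𝕜 q.1 q.2)
        (fun q hq => gapPattern_mem_chamberPatterns (mem_filter.1 (mem_product.1 hq).2).2 q.1)
        gapPattern_injective.injOn

end MomentCurve

section LowerBound

theorem exists_mem_SHL_hasFullDimFacets (d n : ℕ) :
    ∃ k, (∃ f ∈ SHL d (n + 1), HasFullDimFacets f k) ∧ unboundedRegionCount d (n + 1) ≤ k + 1 := by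
  let W := rectVandermonde (fun i : Fin (n + 1) => (i : ℝ)) 1 d
  rcases d.eq_zero_or_pos with rfl | hd
  · refine ⟨0, ⟨conicalNetwork W, conicalNetwork_mem_SHL W, ?_⟩, by simp [unboundedRegionCount]⟩
    simpa using hasFullDimFacets_card (f := conicalNetwork W) (a := Empty.elim) (b := Empty.elim)
      (by simp) (by simp [boundary, conicalNetwork]) Empty.elim (by simp) (by simp)
  · have hW : ∀ i, W.row i ≠ 0 := fun i h => by
      simpa [W, rectVandermonde_apply] using congrFun h ⟨0, hd⟩
    refine ⟨_, ⟨conicalNetwork W, conicalNetwork_mem_SHL W,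
      hasFullDimFacets_conicalNetwork hW⟩, ?_⟩
    calc unboundedRegionCount d (n + 1) ≤ #(chamberPatterns W) :=
          unboundedRegionCount_le_card_chamberPatterns d n
      _ ≤ #((chamberPatterns W).erase ∅) + 1 := Nat.sub_le_iff_le_add.1 pred_card_le_card_erase

end LowerBound

theorem exists_isGreatest_between {A : Set ℕ} {n u : ℕ} (hn : n ∈ A) (hu : ∀ k ∈ A, k ≤ u) :
    ∃ N, IsGreatest A N ∧ n ≤ N ∧ N ≤ u := by
  obtain ⟨N, hN⟩ := BddAbove.exists_isGreatest_of_nonempty ⟨u, hu⟩ ⟨n, hn⟩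
  exact ⟨N, hN, hN.2 hn, hu N hN.1⟩

theorem theorem5 (d m : ℕ) (hm : 1 ≤ m) :
    (∃ N : ℕ, IsGreatest {n : ℕ | ∃ f ∈ SHL d m, HasFacets f n} N ∧
      (unboundedRegionCount d m : ℤ) - 1 ≤ (N : ℤ) ∧ N ≤ regionCount d m) ∧
    (∃ N : ℕ, IsGreatest {n : ℕ | ∃ f ∈ SHL d m, HasFullDimFacets f n} N ∧
      (unboundedRegionCount d m : ℤ) - 1 ≤ (N : ℤ) ∧ N ≤ regionCount d m) := by
  obtain ⟨n, rfl⟩ := Nat.exists_eq_add_of_le' hm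
  obtain ⟨k, ⟨f, hf, hfk⟩, hk⟩ := exists_mem_SHL_hasFullDimFacets d n
  obtain ⟨N, hN, hkN, hNle⟩ := exists_isGreatest_between
    (A := {n' | ∃ f ∈ SHL d (n + 1), HasFacets f n'}) ⟨f, hf, hfk.hasFacets⟩
    fun _ ⟨_, hg, hfacets⟩ => hfacets.le_regionCount hg
  obtain ⟨N', hN', hkN', hNle'⟩ := exists_isGreatest_between
    (A := {n' | ∃ f ∈ SHL d (n + 1), HasFullDimFacets f n'}) ⟨f, hf, hfk⟩
    fun _ ⟨_, hg, hfacets⟩ => hfacets.hasFacets.le_regionCount hg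
  exact ⟨⟨N, hN, by omega, hNle⟩, ⟨N', hN', by omega, hNle'⟩⟩
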